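/- Let $G=(V,E)$ be a finite connected simple undirected graph, each node of which carries a fixed label, public or private. Write $d_i$ for the degree of $v_i$ in $G$. Public-clusters are the connected components of the subgraph of $G$ induced by the public nodes. Let $C^*=(V^*,E^*)$ be a public-cluster with the largest number of nodes, let $n^*=|V^*|$, assume $n^*\ge 2$, and for $v_i\in V^*$ let $d_i^*$ be the number of neighbours of $v_i$ in $C^*$. Consider the following random walk $(x_k)_{k\ge1}$. The seed $v_{x_1}$ is a node of $V^*$ with an arbitrary distribution. Given the samples up to $x_k$, neighbours of $v_{x_k}$ in $G$ are selected independently and uniformly at random until a public one is found, and this public neighbour is $v_{x_{k+1}}$. For a sample size $r$ and a threshold $m=m(r)\in\mathbb{N}_0$ let $$I=\{(k,l) : 1\le k,l\le r,\ |k-l|\ge m\},\qquad \Phi_n=\frac1{|I|}\sum_{(k,l)\in I}\mathbf 1[x_k=x_l],\qquad \hat\Psi_n=\frac1{|I|}\sum_{(k,l)\in I}\frac{d_{x_k}}{d^*_{x_l}},\qquad \hat n=\frac{\hat\Psi_n}{\Phi_n}.$$ Suppose that there is a constant $c<1$ with $m(r)\le c\,r$ for all sufficiently large $r$ (for example, $m$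 is fixed, or $m$ is a fixed proportion less than $1$ of $r$). Then, almost surely, $$\hat n\ \longrightarrow\ \tilde n = n^*\,\frac{\sum_{v_i\in V^*} d_i^*\,d_i}{\sum_{v_i\in V^*}(d_i^*)^2}\qquad\text{as } r\to\infty.$$ -/

import Mathlib

open MeasureTheory Filter Topology

namespace PrivateWalk

noncomputable section

open scoped Classical in
/-- The node set of a public-cluster. `pub` is the set of public nodes, and a public-cluster is a
connected component of the subgraph of `G` induced on the public nodes. -/
def clusterNodes {V : Type*} [Fintype V] (G : SimpleGraph V) (pub : Set V)
    (C : (G.induce pub).ConnectedComponent) : Finset V :=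
  Finset.univ.filter fun v => ∃ h : v ∈ pub, (G.induce pub).connectedComponentMk ⟨v, h⟩ = C

/-- `C` is a largest public-cluster: no public-cluster has more nodes. -/
def IsLargestCluster {V : Type*} [Fintype V] (G : SimpleGraph V) (pub : Set V)
    (C : (G.induce pub).ConnectedComponent) : Prop :=
  ∀ C' : (G.induce pub).ConnectedComponent,
    (clusterNodes G pub C').card ≤ (clusterNodes G pub C).card

open scoped Classical in
/-- The degree `d_v` of `v` in the whole graph (public and private neighbours). -/
def deg {V : Type*} [Fintype V] (G : SimpleGraph V) (v : V) : ℕ :=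
  (Finset.univ.filter fun w => G.Adj v w).card

open scoped Classical in
/-- The public-degree `d*_v`: the number of neighbours of `v` inside the node set `S` of the
largest public-cluster. -/
def pubDeg {V : Type*} (G : SimpleGraph V) (S : Finset V) (v : V) : ℕ :=
  (S.filter fun w => G.Adj v w).card

open scoped Classical in
/-- The probability that a uniformly random neighbour of `v` in the whole graph is `u`. -/
def selectProb {V : Type*} [Fintype V] (G : SimpleGraph V) (v u : V) : ℝ :=
  if G.Adj v u then 1 / (deg G v : ℝ) else 0

open scoped Classical in
/-- The probability that a uniformly random neighbour of `v` is private, so that the selection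
has to be repeated. -/
def rejectProb {V : Type*} [Fintype V] (G : SimpleGraph V) (pub : Set V) (v : V) : ℝ :=
  ∑ u ∈ Finset.univ.filter (fun u => u ∉ pub), selectProb G v u

open scoped Classical in
/-- One step of the designed walk: neighbours of `v` are selected independently and uniformly at
random until a public one is found, and the walk moves there. The summand with index `t` is the
probability of `t` private selections followed by the selection of the public node `w`. -/
def moveProb {V : Type*} [Fintype V] (G : SimpleGraph V) (pub : Set V) (v w : V) : ℝ :=
  if w ∈ pub then ∑' t : ℕ, rejectProb G pub v ^ t * selectProb G v w else 0

/-- `x 1, x 2, …` is a trajectory of the designed random walk with seed in `S`: a random process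
whose first sample lies in `S` (with any distribution there) and which is a Markov chain with
transition probabilities `moveProb`. The value `x 0` is not used. -/
structure IsDesignedWalk {V : Type*} [Fintype V] (G : SimpleGraph V) (pub : Set V) (S : Finset V)
    {Ω : Type*} [MeasurableSpace Ω] (μ : Measure Ω) (x : ℕ → Ω → V) : Prop where
  measurable : ∀ k, 1 ≤ k → ∀ v, MeasurableSet (x k ⁻¹' {v})
  seed : ∀ᵐ ω ∂μ, x 1 ω ∈ S
  step : ∀ r, 1 ≤ r → ∀ i : ℕ → V,
    μ.real {ω | ∀ k ∈ Finset.Icc 1 (r + 1), x k ω = i k} =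
      μ.real {ω | ∀ k ∈ Finset.Icc 1 r, x k ω = i k} * moveProb G pub (i r) (i (r + 1))

/-- The index set `I` of the pairs `(k, l)` with `1 ≤ k, l ≤ r` and `m ≤ |k - l|`. -/
def pairs (m r : ℕ) : Finset (ℕ × ℕ) :=
  (Finset.Icc 1 r ×ˢ Finset.Icc 1 r).filter fun p => (m : ℤ) ≤ |(p.1 : ℤ) - (p.2 : ℤ)|

open scoped Classical in
/-- The average number of collisions `Φ` of a sample sequence `y 1, …, y r`. -/
def collisionAvg {V : Type*} (m r : ℕ) (y : ℕ → V) : ℝ :=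
  (1 / ((pairs m r).card : ℝ)) * ∑ p ∈ pairs m r, if y p.1 = y p.2 then (1 : ℝ) else 0

/-- The average `Ψ̂` of the proposed weights `d_{y k} / d*_{y l}`. -/
def weightAvg {V : Type*} [Fintype V] (G : SimpleGraph V) (S : Finset V) (m r : ℕ)
    (y : ℕ → V) : ℝ :=
  (1 / ((pairs m r).card : ℝ)) *
    ∑ p ∈ pairs m r, (deg G (y p.1) : ℝ) / (pubDeg G S (y p.2) : ℝ)

/-- The proposed size estimate `n̂ = Ψ̂ / Φ`. -/
def sizeEstimate {V : Type*} [Fintype V] (G : SimpleGraph V) (S : Finset V) (m r : ℕ)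
    (y : ℕ → V) : ℝ :=
  weightAvg G S m r y / collisionAvg m r y

/-- The convergence value `ñ = n* (∑ d*_v d_v) / (∑ (d*_v)²)`, sums over the node set `S` of the
largest public-cluster, `n* = |S|`. -/
def limitSize {V : Type*} [Fintype V] (G : SimpleGraph V) (S : Finset V) : ℝ :=
  (S.card : ℝ) * ((∑ v ∈ S, (pubDeg G S v : ℝ) * (deg G v : ℝ)) /
    ∑ v ∈ S, (pubDeg G S v : ℝ) ^ 2)

end

end PrivateWalk

/-!
The walk on the cluster `S` moves to a uniformly chosen neighbour inside `S` (`moveProb_eq`), so its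
stationary distribution is proportional to the public-degree `d*`. Writing `D = ∑ d*`, the theorem
follows from the ergodic theorem for this walk and a deterministic fact about averages over pairs.

The ergodic theorem (`IsDesignedWalk.ae_tendsto_stationaryMean`) needs no aperiodicity. The Poisson
equation `h - P h = F - π F` is solvable because, multiplied by `d*`, it is an equation for the
graph Laplacian of the connected cluster, whose range is the orthogonal complement of the constants
on `S` (`exists_poisson_solution`). Along the walk, `F - π F` is therefore a telescoping term plus
the prediction error `h (x (k + 1)) - P h (x k)`. These errors are bounded and orthogonal by the
Markov property (`IsDesignedWalk.integral_mul_next`), so they obey a strong law of large numbers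
(`ae_tendsto_cesaro_of_orthogonal`), proved by summing variances along the squares.

If two bounded sequences have Cesàro limits `a` and `b`, then the averages of the products
`f k * g l` over the pairs with `|k - l| ≥ m` converge to `a * b` (`tendsto_pairs_average`): after
centring one factor, the sum over its index is a combination of three partial sums, each `o(r)`,
while the number of pairs is at least a constant times `r ^ 2` since `m ≤ c r` with `c < 1`.

Applied to the indicators of the nodes, this gives `Φ → ∑ (d*) ^ 2 / D ^ 2`, and applied to `d` and
`1 / d*` it gives `Ψ̂ → (∑ d* d / D) (n* / D)`. The quotient of the two limits is the claim.
-/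

namespace PrivateWalk

/-! ### Averages over index pairs -/

lemma sum_Icc_one_eq_sum_range (f : ℕ → ℝ) (r : ℕ) :
    ∑ k ∈ Finset.Icc 1 r, f k = ∑ k ∈ Finset.range r, f (k + 1) := by
  induction r with
  | zero => simp
  | succ n ih => rw [Finset.sum_Icc_succ_top (by omega), Finset.sum_range_succ, ih]

/-- The indices `k ≤ r` at distance at least `m` from `l` are the complement of an interval in
`[1, r]`, so a sum over them is a combination of three partial sums. -/
lemma abs_sum_far_le {f : ℕ → ℝ} {r : ℕ} {M : ℝ}
    (hM : ∀ j ≤ r, |∑ k ∈ Finset.Icc 1 j, f k| ≤ M) (m l : ℕ) (hl : l ≤ r) :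
    |∑ k ∈ (Finset.Icc 1 r).filter (fun k : ℕ => (m : ℤ) ≤ |(k : ℤ) - (l : ℤ)|), f k| ≤ 3 * M := by
  have h0 : 0 ≤ M := (abs_nonneg _).trans (hM 0 (Nat.zero_le _))
  rcases Nat.eq_zero_or_pos m with rfl | hm
  · rw [Finset.filter_true_of_mem (fun k _ => by simp)]
    linarith [hM r le_rfl]
  have hsplit := Finset.sum_filter_add_sum_filter_not (Finset.Icc 1 r)
    (fun k : ℕ => (m : ℤ) ≤ |(k : ℤ) - (l : ℤ)|) f
  have hnear : (Finset.Icc 1 r).filter (fun k : ℕ => ¬ (m : ℤ) ≤ |(k : ℤ) - (l : ℤ)|) =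
      Finset.Icc 1 (min r (l + m - 1)) \ Finset.Icc 1 (l - m) := by
    ext k
    simp only [Finset.mem_filter, Finset.mem_Icc, Finset.mem_sdiff, le_abs]
    omega
  have hsub : Finset.Icc 1 (l - m) ⊆ Finset.Icc 1 (min r (l + m - 1)) :=
    Finset.Icc_subset_Icc_right (by omega)
  have hdiff := Finset.sum_sdiff (f := f) hsub
  rw [hnear] at hsplit
  have h1 := abs_le.1 (hM r le_rfl)
  have h2 := abs_le.1 (hM (min r (l + m - 1)) (by omega))
  have h3 := abs_le.1 (hM (l - m) (by omega))
  rw [abs_le]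
  constructor <;> linarith

lemma sum_pairs_eq (m r : ℕ) (f g : ℕ → ℝ) :
    ∑ p ∈ pairs m r, f p.1 * g p.2 = ∑ l ∈ Finset.Icc 1 r, g l *
      ∑ k ∈ (Finset.Icc 1 r).filter (fun k : ℕ => (m : ℤ) ≤ |(k : ℤ) - (l : ℤ)|), f k := by
  rw [pairs, Finset.sum_filter, Finset.sum_product_right]
  refine Finset.sum_congr rfl fun l _ => ?_
  rw [Finset.mul_sum, Finset.sum_filter]
  exact Finset.sum_congr rfl fun k _ => by split_ifs <;> ring

lemma sum_pairs_swap (m r : ℕ) (f : ℕ → ℕ → ℝ) :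
    ∑ p ∈ pairs m r, f p.1 p.2 = ∑ p ∈ pairs m r, f p.2 p.1 := by
  refine Finset.sum_nbij' Prod.swap Prod.swap ?_ ?_ ?_ ?_ ?_ <;>
    simp +contextual [pairs, abs_sub_comm]

/-- Summing a sequence with vanishing Cesàro means against a bounded one over the index pairs
gives `o(r ^ 2)`, uniformly in the gap `m`. -/
lemma tendsto_sum_pairs_div_sq {f g : ℕ → ℝ} {B : ℝ} (hg : ∀ k, |g k| ≤ B)
    (hf : Tendsto (fun r : ℕ => (∑ k ∈ Finset.range r, f (k + 1)) / (r : ℝ)) atTop (𝓝 0))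
    (m : ℕ → ℕ) :
    Tendsto (fun r : ℕ => (∑ p ∈ pairs (m r) r, f p.1 * g p.2) / (r : ℝ) ^ 2) atTop (𝓝 0) := by
  have hB : 0 ≤ B := (abs_nonneg _).trans (hg 0)
  rw [Metric.tendsto_atTop]
  intro ε hε
  -- the sum over pairs will be at most `r * B * 3 * (2 * δ * r)`, as soon as `K < δ r` below
  set δ : ℝ := ε / (6 * (B + 1)) with hδ
  have hδ0 : 0 < δ := by positivity
  obtain ⟨N, hN⟩ := Metric.tendsto_atTop.1 hf δ hδ0
  set K : ℝ := ∑ j ∈ Finset.range N, |∑ k ∈ Finset.Icc 1 j, f k| with hK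
  have hK0 : 0 ≤ K := Finset.sum_nonneg fun _ _ => abs_nonneg _
  -- partial sums up to `r` are at most `K + δ r`, with `K` paying for the first `N` of them
  have hpart : ∀ r : ℕ, ∀ j ≤ r, |∑ k ∈ Finset.Icc 1 j, f k| ≤ K + δ * r := by
    intro r j hj
    have hjr : (j : ℝ) ≤ r := by exact_mod_cast hj
    rcases lt_or_ge j N with h | h
    · have := Finset.single_le_sum (f := fun j => |∑ k ∈ Finset.Icc 1 j, f k|)
        (fun _ _ => abs_nonneg _) (Finset.mem_range.2 h)
      have h2 : 0 ≤ δ * r := by positivity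
      rw [← hK] at this
      linarith
    · rcases Nat.eq_zero_or_pos j with rfl | hj0
      · simp; positivity
      have h1 := hN j h
      rw [Real.dist_eq, sub_zero, abs_div, Nat.abs_cast, div_lt_iff₀ (by exact_mod_cast hj0),
        ← sum_Icc_one_eq_sum_range] at h1
      nlinarith
  obtain ⟨N', hN'⟩ := exists_nat_gt (K / δ)
  refine ⟨N' + 1, fun r hr => ?_⟩
  have hr0 : (0 : ℝ) < r := by exact_mod_cast (by omega : 0 < r)
  have hKr : K < δ * r := by
    have : (N' : ℝ) ≤ r := by exact_mod_cast (by omega : N' ≤ r)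
    rw [div_lt_iff₀ hδ0] at hN'
    nlinarith
  rw [Real.dist_eq, sub_zero, abs_div, abs_of_pos (by positivity : (0 : ℝ) < (r : ℝ) ^ 2),
    div_lt_iff₀ (by positivity), sum_pairs_eq]
  have hbound : ∀ l ∈ Finset.Icc 1 r, |g l *
      ∑ k ∈ (Finset.Icc 1 r).filter (fun k : ℕ => ((m r : ℕ) : ℤ) ≤ |(k : ℤ) - (l : ℤ)|), f k| ≤
        B * (3 * (K + δ * r)) := by
    intro l hl
    rw [abs_mul]
    exact mul_le_mul (hg l) (abs_sum_far_le (hpart r) _ _ (Finset.mem_Icc.1 hl).2)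
      (abs_nonneg _) hB
  have h := (Finset.abs_sum_le_sum_abs _ _).trans (Finset.sum_le_sum hbound)
  rw [Finset.sum_const, Nat.card_Icc, nsmul_eq_mul, Nat.add_sub_cancel] at h
  have hBδ : B * (6 * δ) < ε := by
    have : ε = 6 * δ * (B + 1) := by rw [hδ]; field_simp
    nlinarith
  calc _ ≤ (r : ℝ) * (B * (3 * (K + δ * r))) := h
    _ ≤ (r : ℝ) * (B * (3 * (δ * r + δ * r))) := by gcongr
    _ = (B * (6 * δ)) * (r : ℝ) ^ 2 := by ring
    _ < ε * (r : ℝ) ^ 2 := by gcongr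

/-- The pairs with `l` among the first and `k` among the last `⌊(r - m + 1) / 2⌋` indices already
make up a positive proportion of all `r ^ 2` pairs. -/
lemma card_pairs_ge {m r : ℕ} (h : m ≤ r) :
    ((r : ℝ) - m) ^ 2 / 4 ≤ ((pairs m r).card : ℝ) := by
  set s := (r - m + 1) / 2 with hs
  have hsub : Finset.Icc (r - s + 1) r ×ˢ Finset.Icc 1 s ⊆ pairs m r := by
    rintro ⟨k, l⟩ hp
    simp only [Finset.mem_product, Finset.mem_Icc] at hp
    simp only [pairs, Finset.mem_filter, Finset.mem_product, Finset.mem_Icc, le_abs]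
    omega
  have hcard := Finset.card_le_card hsub
  rw [Finset.card_product, Nat.card_Icc, Nat.card_Icc,
    (by omega : r + 1 - (r - s + 1) = s), Nat.add_sub_cancel] at hcard
  have h1 : (r : ℝ) - m ≤ 2 * s := by
    have : r ≤ 2 * s + m := by omega
    have : (r : ℝ) ≤ 2 * s + m := by exact_mod_cast this
    linarith
  have h2 : (0 : ℝ) ≤ (r : ℝ) - m := sub_nonneg.2 (by exact_mod_cast h)
  have h3 : (s : ℝ) * s ≤ (pairs m r).card := by exact_mod_cast hcard
  nlinarith

/-- If two bounded sequences have Cesàro limits `a` and `b`, the averages of the products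
`f k * g l` over the index pairs converge to `a * b`. -/
lemma tendsto_pairs_average {f g : ℕ → ℝ} {a b B : ℝ} (hg : ∀ k, |g k| ≤ B)
    (hfa : Tendsto (fun r : ℕ => (∑ k ∈ Finset.range r, f (k + 1)) / (r : ℝ)) atTop (𝓝 a))
    (hgb : Tendsto (fun r : ℕ => (∑ k ∈ Finset.range r, g (k + 1)) / (r : ℝ)) atTop (𝓝 b))
    {m : ℕ → ℕ} {c : ℝ} (hc : c < 1) (hm : ∀ᶠ r : ℕ in atTop, (m r : ℝ) ≤ c * (r : ℝ)) :
    Tendsto (fun r : ℕ => (1 / ((pairs (m r) r).card : ℝ)) *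
      ∑ p ∈ pairs (m r) r, f p.1 * g p.2) atTop (𝓝 (a * b)) := by
  have center : ∀ {u : ℕ → ℝ} {t : ℝ},
      Tendsto (fun r : ℕ => (∑ k ∈ Finset.range r, u (k + 1)) / (r : ℝ)) atTop (𝓝 t) →
      Tendsto (fun r : ℕ => (∑ k ∈ Finset.range r, (u (k + 1) - t)) / (r : ℝ)) atTop (𝓝 0) := by
    intro u t hu
    have := hu.sub_const t
    rw [sub_self] at this
    refine this.congr' ?_
    filter_upwards [eventually_gt_atTop 0] with r hr
    have : (r : ℝ) ≠ 0 := by positivity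
    rw [Finset.sum_sub_distrib, Finset.sum_const, Finset.card_range, nsmul_eq_mul]
    field_simp
  have h1 := tendsto_sum_pairs_div_sq (f := fun k => f k - a) hg (center hfa) m
  have h2 := tendsto_sum_pairs_div_sq (f := fun k => g k - b) (g := fun _ => a) (B := |a|)
    (fun _ => le_rfl) (center hgb) m
  have h3 := h1.add h2
  rw [add_zero] at h3
  have hcard : ∀ᶠ r : ℕ in atTop, 0 < (r : ℝ) ∧
      (1 - c) ^ 2 / 4 * (r : ℝ) ^ 2 ≤ ((pairs (m r) r).card : ℝ) := by
    filter_upwards [hm, eventually_gt_atTop 0] with r hr hr0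
    have hr0' : (0 : ℝ) < r := by exact_mod_cast hr0
    refine ⟨hr0', ?_⟩
    have hlow : (1 - c) * r ≤ (r : ℝ) - m r := by linarith
    have hpos : 0 < (1 - c) * r := mul_pos (by linarith) hr0'
    have hmr : m r ≤ r := by exact_mod_cast (by linarith : (m r : ℝ) ≤ r)
    refine le_trans ?_ (card_pairs_ge hmr)
    nlinarith
  have h4 : Tendsto (fun r : ℕ => (1 / ((pairs (m r) r).card : ℝ)) *
      ∑ p ∈ pairs (m r) r, f p.1 * g p.2 - a * b) atTop (𝓝 0) := by
    have h5 := (h3.abs).mul_const (4 / (1 - c) ^ 2)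
    rw [abs_zero, zero_mul] at h5
    refine squeeze_zero_norm' ?_ h5
    filter_upwards [hcard] with r ⟨hr0, hr⟩
    have hc1 : 0 < (1 - c) ^ 2 := by nlinarith
    have hN : (0 : ℝ) < (pairs (m r) r).card := lt_of_lt_of_le (by positivity) hr
    have hsum : ∑ p ∈ pairs (m r) r, (f p.1 - a) * g p.2 + ∑ p ∈ pairs (m r) r, (g p.1 - b) * a =
        ∑ p ∈ pairs (m r) r, f p.1 * g p.2 - (pairs (m r) r).card * (a * b) := by
      rw [sum_pairs_swap _ _ (fun k _ => (g k - b) * a), ← Finset.sum_add_distrib,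
        ← nsmul_eq_mul, ← Finset.sum_const, ← Finset.sum_sub_distrib]
      exact Finset.sum_congr rfl fun p _ => by ring
    rw [← add_div, hsum, Real.norm_eq_abs, abs_div, abs_of_pos (by positivity : 0 < (r : ℝ) ^ 2)]
    have heq : (1 / ((pairs (m r) r).card : ℝ)) * ∑ p ∈ pairs (m r) r, f p.1 * g p.2 - a * b =
        (∑ p ∈ pairs (m r) r, f p.1 * g p.2 - (pairs (m r) r).card * (a * b)) /
          (pairs (m r) r).card := by
      field_simp
    rw [heq, abs_div, abs_of_pos hN, div_mul_div_comm]
    rw [div_le_div_iff₀ hN (by positivity)]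
    have := mul_le_mul_of_nonneg_left hr (abs_nonneg
      (∑ p ∈ pairs (m r) r, f p.1 * g p.2 - (pairs (m r) r).card * (a * b)))
    linarith
  simpa using h4.add_const (a * b)

/-! ### A strong law for bounded orthogonal variables -/

/-- If the sum of a sequence bounded by `K` is `o(n ^ 2)` up to time `n ^ 2`, then its Cesàro means
vanish: between consecutive squares the sum changes by at most `2 K n`. -/
lemma tendsto_cesaro_of_tendsto_along_squares {u : ℕ → ℝ} {K : ℝ} (hu : ∀ k, |u k| ≤ K)
    (h : Tendsto (fun n : ℕ => (∑ k ∈ Finset.range (n ^ 2), u k) / (n : ℝ) ^ 2) atTop (𝓝 0)) :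
    Tendsto (fun r : ℕ => (∑ k ∈ Finset.range r, u k) / (r : ℝ)) atTop (𝓝 0) := by
  have hK : 0 ≤ K := (abs_nonneg _).trans (hu 0)
  have hsq : Tendsto Nat.sqrt atTop atTop :=
    tendsto_atTop_atTop.2 fun b => ⟨b * b, fun a ha => Nat.le_sqrt.2 ha⟩
  have h1 : Tendsto (fun n : ℕ => |(∑ k ∈ Finset.range (n ^ 2), u k) / (n : ℝ) ^ 2| +
      2 * K * (n : ℝ)⁻¹) atTop (𝓝 0) := by
    have := h.abs.add ((tendsto_inv_atTop_nhds_zero_nat (𝕜 := ℝ)).const_mul (2 * K))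
    simpa using this
  refine squeeze_zero_norm' ?_ (h1.comp hsq)
  filter_upwards [eventually_gt_atTop 0] with r hr
  set n := Nat.sqrt r with hn
  have hn0 : 0 < n := Nat.sqrt_pos.2 hr
  have hle : n ^ 2 ≤ r := Nat.sqrt_le' r
  have hlt : r ≤ n ^ 2 + 2 * n := by nlinarith [Nat.sqrt_le_add r]
  have hn0' : (0 : ℝ) < n := by exact_mod_cast hn0
  have hle' : (n : ℝ) ^ 2 ≤ r := by exact_mod_cast hle
  have hlt' : (r : ℝ) - (n : ℝ) ^ 2 ≤ 2 * n := by
    have : (r : ℝ) ≤ (n : ℝ) ^ 2 + 2 * n := by exact_mod_cast hlt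
    linarith
  -- at most `2 n` terms separate `r` from the square `n ^ 2` below it
  have hgap : |∑ k ∈ Finset.Ico (n ^ 2) r, u k| ≤ 2 * n * K := by
    refine (Finset.abs_sum_le_sum_abs _ _).trans ((Finset.sum_le_sum fun k _ => hu k).trans ?_)
    rw [Finset.sum_const, Nat.card_Ico, nsmul_eq_mul, Nat.cast_sub hle]
    push_cast
    gcongr
  have hr0 : (0 : ℝ) < r := by exact_mod_cast hr
  rw [Real.norm_eq_abs, abs_div, abs_of_pos hr0, Function.comp_apply, ← hn, abs_div,
    abs_of_pos (by positivity : 0 < (n : ℝ) ^ 2), ← Finset.sum_range_add_sum_Ico _ hle]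
  calc |∑ k ∈ Finset.range (n ^ 2), u k + ∑ k ∈ Finset.Ico (n ^ 2) r, u k| / (r : ℝ)
      ≤ (|∑ k ∈ Finset.range (n ^ 2), u k| + 2 * n * K) / (n : ℝ) ^ 2 := by
        gcongr
        exact (abs_add_le _ _).trans (by gcongr)
    _ = |∑ k ∈ Finset.range (n ^ 2), u k| / (n : ℝ) ^ 2 + 2 * K * (n : ℝ)⁻¹ := by
        field_simp

section OrthogonalVariables

variable {Ω : Type*} [MeasurableSpace Ω]

lemma integral_sq_sum_le_of_orthogonal (μ : Measure Ω) [IsProbabilityMeasure μ] {X : ℕ → Ω → ℝ}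
    {K : ℝ} (hX : ∀ k, Measurable (X k)) (hK : ∀ k ω, |X k ω| ≤ K)
    (horth : ∀ j k, j < k → ∫ ω, X j ω * X k ω ∂μ = 0) (r : ℕ) :
    ∫ ω, (∑ k ∈ Finset.range r, X k ω) ^ 2 ∂μ ≤ r * K ^ 2 := by
  have hint : ∀ j k, Integrable (fun ω => X j ω * X k ω) μ := fun j k =>
    Integrable.of_bound ((hX j).mul (hX k)).aestronglyMeasurable (K * K)
      (ae_of_all _ fun ω => by
        rw [Real.norm_eq_abs, abs_mul]
        exact mul_le_mul (hK j ω) (hK k ω) (abs_nonneg _) ((abs_nonneg _).trans (hK j ω)))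
  have hexp : ∀ ω, (∑ k ∈ Finset.range r, X k ω) ^ 2 =
      ∑ j ∈ Finset.range r, ∑ k ∈ Finset.range r, X j ω * X k ω := fun ω => by
    rw [sq, Finset.sum_mul_sum]
  simp_rw [hexp]
  rw [integral_finsetSum _ fun j _ => integrable_finsetSum _ fun k _ => hint j k]
  have hrow : ∀ j ∈ Finset.range r,
      ∫ ω, ∑ k ∈ Finset.range r, X j ω * X k ω ∂μ ≤ K ^ 2 := by
    intro j hj
    rw [integral_finsetSum _ fun k _ => hint j k, Finset.sum_eq_single_of_mem j hj]
    · calc ∫ ω, X j ω * X j ω ∂μ ≤ ∫ _, K ^ 2 ∂μ :=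
            integral_mono (hint j j) (integrable_const _) fun ω => by
              rw [← sq]; exact sq_le_sq.2 ((hK j ω).trans (le_abs_self K))
        _ = K ^ 2 := by simp
    · intro k _ hkj
      rcases lt_or_gt_of_ne hkj with h | h
      · rw [← horth k j h]; simp_rw [mul_comm]
      · exact horth j k h
  refine (Finset.sum_le_sum hrow).trans (by simp)

/-- Strong law of large numbers for bounded orthogonal variables: the variances of the means along
the squares are summable, and the means in between are controlled by boundedness. -/
lemma ae_tendsto_cesaro_of_orthogonal (μ : Measure Ω) [IsProbabilityMeasure μ] {X : ℕ → Ω → ℝ}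
    {K : ℝ} (hX : ∀ k, Measurable (X k)) (hK : ∀ k ω, |X k ω| ≤ K)
    (horth : ∀ j k, j < k → ∫ ω, X j ω * X k ω ∂μ = 0) :
    ∀ᵐ ω ∂μ, Tendsto (fun r : ℕ => (∑ k ∈ Finset.range r, X k ω) / (r : ℝ)) atTop (𝓝 0) := by
  set Z : ℕ → Ω → ℝ := fun n ω => ((∑ k ∈ Finset.range (n ^ 2), X k ω) / (n : ℝ) ^ 2) ^ 2 with hZ
  have hZm : ∀ n, Measurable (Z n) := fun n =>
    ((Finset.measurable_fun_sum _ fun k _ => hX k).div_const _).pow_const 2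
  have hZint : ∀ n, ∫⁻ ω, ENNReal.ofReal (Z n ω) ∂μ ≤
      ENNReal.ofReal (K ^ 2 * (1 / (n : ℝ) ^ 2)) := by
    intro n
    have hbd : ∀ ω, ‖Z n ω‖ ≤ (((n ^ 2 : ℕ) : ℝ) * K / (n : ℝ) ^ 2) ^ 2 := by
      intro ω
      have : |∑ k ∈ Finset.range (n ^ 2), X k ω| ≤ ((n ^ 2 : ℕ) : ℝ) * K := by
        refine (Finset.abs_sum_le_sum_abs _ _).trans
          ((Finset.sum_le_sum fun k _ => hK k ω).trans ?_)
        simp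
      rw [hZ, Real.norm_eq_abs, abs_pow, abs_div, abs_pow, Nat.abs_cast]
      gcongr
    rw [← ofReal_integral_eq_lintegral_ofReal
      (Integrable.of_bound (hZm n).aestronglyMeasurable _ (ae_of_all _ hbd))
      (ae_of_all _ fun ω => sq_nonneg _)]
    apply ENNReal.ofReal_le_ofReal
    simp_rw [hZ, div_pow]
    rw [integral_div]
    rcases Nat.eq_zero_or_pos n with rfl | hn
    · simp
    have hn' : (0 : ℝ) < n := by exact_mod_cast hn
    rw [div_le_iff₀ (by positivity)]
    refine (integral_sq_sum_le_of_orthogonal μ hX hK horth (n ^ 2)).trans (le_of_eq ?_)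
    push_cast
    field_simp
  have hsum : Summable fun n : ℕ => K ^ 2 * (1 / (n : ℝ) ^ 2) :=
    (Real.summable_one_div_nat_pow.2 one_lt_two).mul_left _
  have hfin : ∫⁻ ω, ∑' n, ENNReal.ofReal (Z n ω) ∂μ ≠ ⊤ := by
    rw [lintegral_tsum fun n => (hZm n).ennreal_ofReal.aemeasurable]
    exact ne_top_of_le_ne_top hsum.tsum_ofReal_ne_top (ENNReal.tsum_le_tsum hZint)
  filter_upwards [ae_lt_top (Measurable.tsum fun n => (hZm n).ennreal_ofReal) hfin]
    with ω hω
  refine tendsto_cesaro_of_tendsto_along_squares (fun k => hK k ω) ?_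
  have h0 := ENNReal.tendsto_atTop_zero_of_tsum_ne_top hω.ne
  have h1 : Tendsto (fun n => Z n ω) atTop (𝓝 0) := by
    have := (ENNReal.tendsto_toReal ENNReal.zero_ne_top).comp h0
    simpa [Function.comp_def, ENNReal.toReal_ofReal (show 0 ≤ Z _ ω from sq_nonneg _)] using this
  have h2 := h1.sqrt
  simp only [hZ, Real.sqrt_sq_eq_abs, Real.sqrt_zero] at h2
  exact (tendsto_zero_iff_abs_tendsto_zero _).2 h2

end OrthogonalVariables

/-! ### The walk on the cluster and its Poisson equation -/

/-- The graph Laplacian is symmetric, so its range is the orthogonal complement of its kernel, the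
functions that are constant along edges. -/
lemma exists_lapMatrix_mulVec_eq {V : Type*} [Fintype V] [DecidableEq V] (H : SimpleGraph V)
    [DecidableRel H.Adj] (b : V → ℝ)
    (hb : ∀ y : V → ℝ, (∀ i j, H.Adj i j → y i = y j) → ∑ v, y v * b v = 0) :
    ∃ h : V → ℝ, (H.lapMatrix ℝ).mulVec h = b := by
  -- otherwise a functional vanishing on the range, given by a vector `y`, does not vanish at `b`
  by_contra hne
  have hmem : b ∉ LinearMap.range (H.lapMatrix ℝ).mulVecLin := by
    rintro ⟨h, hh⟩
    exact hne ⟨h, hh⟩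
  obtain ⟨f, hfb, hf⟩ := Submodule.exists_le_ker_of_notMem hmem
  set y : V → ℝ := fun v => f (Pi.single v 1) with hy
  have hfy : ∀ u : V → ℝ, f u = y ⬝ᵥ u := by
    intro u
    conv_lhs => rw [pi_eq_sum_univ' u]
    simp [dotProduct, hy, mul_comm, map_sum]
  have hLy : (H.lapMatrix ℝ).mulVec y = 0 := by
    refine dotProduct_eq_zero _ fun u => ?_
    have h1 : f ((H.lapMatrix ℝ).mulVec u) = 0 := hf ⟨u, rfl⟩
    rw [hfy, Matrix.dotProduct_mulVec, ← Matrix.mulVec_transpose,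
      (H.isSymm_lapMatrix (R := ℝ)).eq] at h1
    exact h1
  exact hfb ((hfy b).trans (hb y ((H.lapMatrix_mulVec_eq_zero_iff_forall_adj).1 hLy)))

section Cluster

variable {V : Type*} [Fintype V] {G : SimpleGraph V} {pub : Set V}
  {C : (G.induce pub).ConnectedComponent}

lemma mem_clusterNodes {v : V} : v ∈ clusterNodes G pub C ↔
    ∃ h : v ∈ pub, (G.induce pub).connectedComponentMk ⟨v, h⟩ = C := by
  simp [clusterNodes]

lemma mem_clusterNodes_iff_of_adj {v w : V} (hv : v ∈ clusterNodes G pub C) (hvw : G.Adj v w) :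
    w ∈ clusterNodes G pub C ↔ w ∈ pub := by
  obtain ⟨hvp, hvC⟩ := mem_clusterNodes.1 hv
  refine ⟨fun h => (mem_clusterNodes.1 h).1, fun hw => mem_clusterNodes.2 ⟨hw, ?_⟩⟩
  rw [← hvC]
  have : (G.induce pub).Adj ⟨w, hw⟩ ⟨v, hvp⟩ := hvw.symm
  exact SimpleGraph.ConnectedComponent.sound this.reachable

/-- Connectedness of a cluster, expressed through locally constant functions. -/
lemma eq_of_forall_adj_clusterNodes {y : V → ℝ}
    (hy : ∀ u ∈ clusterNodes G pub C, ∀ v ∈ clusterNodes G pub C, G.Adj u v → y u = y v)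
    {u v : V} (hu : u ∈ clusterNodes G pub C) (hv : v ∈ clusterNodes G pub C) : y u = y v := by
  obtain ⟨hup, huC⟩ := mem_clusterNodes.1 hu
  obtain ⟨hvp, hvC⟩ := mem_clusterNodes.1 hv
  obtain ⟨p⟩ := SimpleGraph.ConnectedComponent.exact (huC.trans hvC.symm)
  have key : ∀ {a b : pub} (_ : (G.induce pub).Walk a b), a.1 ∈ clusterNodes G pub C →
      y a.1 = y b.1 := by
    intro a b p
    induction p with
    | nil => intro _; rfl
    | @cons a b c hab _ ih =>
      intro ha
      have hab' : G.Adj a.1 b.1 := hab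
      have hb := (mem_clusterNodes_iff_of_adj ha hab').2 b.2
      exact (hy _ ha _ hb hab').trans (ih hb)
  exact key p hu

lemma pubDeg_pos (hC2 : 2 ≤ (clusterNodes G pub C).card) {v : V}
    (hv : v ∈ clusterNodes G pub C) : 0 < pubDeg G (clusterNodes G pub C) v := by
  classical
  by_contra h0
  have hno : ∀ w ∈ clusterNodes G pub C, ¬ G.Adj v w := by
    have : pubDeg G (clusterNodes G pub C) v = 0 := by omega
    rw [pubDeg, Finset.card_eq_zero, Finset.filter_eq_empty_iff] at this
    exact fun w hw => this hw
  obtain ⟨w, hw, hwv⟩ := Finset.exists_mem_ne (s := clusterNodes G pub C) (by omega) v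
  -- the indicator of an isolated node would be locally constant
  have := eq_of_forall_adj_clusterNodes (y := fun u => if u = v then (1 : ℝ) else 0)
    (fun a ha b hb hab => by
      have h1 : a ≠ v := fun h => hno b hb (h ▸ hab)
      have h2 : b ≠ v := fun h => hno a ha (h ▸ hab.symm)
      simp [h1, h2]) hv hw
  simp [hwv] at this

lemma rejectProb_eq {v : V} (hv : v ∈ clusterNodes G pub C) (hd : 0 < deg G v) :
    rejectProb G pub v = 1 - (pubDeg G (clusterNodes G pub C) v : ℝ) / (deg G v : ℝ) := by
  classical
  have hd' : (0 : ℝ) < deg G v := by exact_mod_cast hd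
  have hsplit := Finset.card_filter_add_card_filter_not
    (s := Finset.univ.filter fun w => G.Adj v w) (p := fun w => w ∈ pub)
  have hpub : (Finset.univ.filter fun w => G.Adj v w).filter (fun w => w ∈ pub) =
      (clusterNodes G pub C).filter fun w => G.Adj v w := by
    ext w
    simp only [Finset.mem_filter, Finset.mem_univ, true_and]
    constructor
    · rintro ⟨h1, h2⟩
      exact ⟨(mem_clusterNodes_iff_of_adj hv h1).2 h2, h1⟩
    · rintro ⟨h1, h2⟩
      exact ⟨h2, (mem_clusterNodes_iff_of_adj hv h2).1 h1⟩
  have hrej : rejectProb G pub v =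
      (((Finset.univ.filter fun w => G.Adj v w).filter (fun w => w ∉ pub)).card : ℝ) /
        (deg G v : ℝ) := by
    rw [rejectProb, Finset.filter_filter]
    simp only [selectProb]
    rw [← Finset.sum_filter, Finset.filter_filter, Finset.sum_const, nsmul_eq_mul, mul_one_div]
    simp only [and_comm]
  have hdeg : deg G v = (Finset.univ.filter fun w => G.Adj v w).card := by
    simp only [deg]
  have hpd : pubDeg G (clusterNodes G pub C) v =
      ((clusterNodes G pub C).filter fun w => G.Adj v w).card := by
    simp only [pubDeg]
  rw [hpub, ← hpd, ← hdeg] at hsplit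
  rw [hrej, eq_sub_iff_add_eq, ← add_div, div_eq_one_iff_eq hd'.ne']
  exact_mod_cast (add_comm _ _).trans hsplit

open scoped Classical in
/-- On the cluster, rejecting private neighbours leaves a uniform choice among the neighbours in
the cluster (a geometric series in the rejection probability). -/
lemma moveProb_eq (hC2 : 2 ≤ (clusterNodes G pub C).card) {v : V}
    (hv : v ∈ clusterNodes G pub C) (w : V) :
    moveProb G pub v w = if w ∈ clusterNodes G pub C ∧ G.Adj v w then
      1 / (pubDeg G (clusterNodes G pub C) v : ℝ) else 0 := by
  have hp := pubDeg_pos hC2 hv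
  have hle : pubDeg G (clusterNodes G pub C) v ≤ deg G v :=
    Finset.card_le_card (Finset.filter_subset_filter _ (Finset.subset_univ _))
  have hp' : (0 : ℝ) < pubDeg G (clusterNodes G pub C) v := by exact_mod_cast hp
  have hd' : (0 : ℝ) < deg G v := by exact_mod_cast hp.trans_le hle
  have hle' : (pubDeg G (clusterNodes G pub C) v : ℝ) ≤ deg G v := by exact_mod_cast hle
  by_cases hvw : G.Adj v w
  · simp only [moveProb, mem_clusterNodes_iff_of_adj hv hvw, hvw, and_true]
    refine if_congr Iff.rfl ?_ rfl
    have hdiv : (pubDeg G (clusterNodes G pub C) v : ℝ) / deg G v ≤ 1 := (div_le_one hd').2 hle'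
    have hdiv0 : 0 < (pubDeg G (clusterNodes G pub C) v : ℝ) / deg G v := by positivity
    rw [tsum_mul_right, rejectProb_eq hv (hp.trans_le hle),
      tsum_geometric_of_lt_one (by linarith) (by linarith), selectProb, if_pos hvw, sub_sub_cancel]
    field_simp
  · simp [moveProb, hvw, selectProb]

/-- The mean of `F` under the stationary distribution of the walk on `S`, whose weights are
proportional to the public-degrees. -/
noncomputable def stationaryMean (G : SimpleGraph V) (S : Finset V) (F : V → ℝ) : ℝ :=
  (∑ v ∈ S, (pubDeg G S v : ℝ) * F v) / ∑ v ∈ S, (pubDeg G S v : ℝ)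

lemma sum_pubDeg_pos (hC2 : 2 ≤ (clusterNodes G pub C).card) :
    (0 : ℝ) < ∑ v ∈ clusterNodes G pub C, (pubDeg G (clusterNodes G pub C) v : ℝ) :=
  Finset.sum_pos (fun _ hv => by exact_mod_cast pubDeg_pos hC2 hv)
    (Finset.card_pos.1 (by omega))

/-- The Poisson equation of the walk on the cluster. Multiplied by the public-degree it becomes an
equation for the Laplacian of the cluster. -/
lemma exists_poisson_solution (hC2 : 2 ≤ (clusterNodes G pub C).card) (F : V → ℝ) :
    ∃ h : V → ℝ, ∀ v ∈ clusterNodes G pub C, h v - ∑ w, moveProb G pub v w * h w =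
      F v - stationaryMean G (clusterNodes G pub C) F := by
  classical
  set S := clusterNodes G pub C with hS
  -- the cluster as a graph on all of `V`, with the other nodes isolated
  let H : SimpleGraph V :=
    { Adj := fun v w => (v ∈ S ∧ w ∈ S) ∧ G.Adj v w
      symm := ⟨fun v w h => ⟨h.1.symm, h.2.symm⟩⟩
      loopless := ⟨fun v h => G.loopless.irrefl v h.2⟩ }
  have hD := sum_pubDeg_pos hC2
  obtain ⟨h, hh⟩ := exists_lapMatrix_mulVec_eq H
    (fun v => if v ∈ S then (pubDeg G S v : ℝ) * (F v - stationaryMean G S F) else 0) (by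
      intro y hy
      obtain ⟨u, hu⟩ : S.Nonempty := Finset.card_pos.1 (by omega)
      have hconst : ∀ v ∈ S, y v = y u := fun v hv =>
        eq_of_forall_adj_clusterNodes (fun a ha b hb hab => hy a b ⟨⟨ha, hb⟩, hab⟩) hv hu
      simp only [mul_ite, mul_zero]
      rw [← Finset.sum_filter, Finset.filter_mem_eq_inter, Finset.univ_inter]
      have : ∀ v ∈ S, y v * ((pubDeg G S v : ℝ) * (F v - stationaryMean G S F)) =
          y u * ((pubDeg G S v : ℝ) * F v - stationaryMean G S F * (pubDeg G S v : ℝ)) :=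
        fun v hv => by rw [hconst v hv]; ring
      rw [Finset.sum_congr rfl this, ← Finset.mul_sum, Finset.sum_sub_distrib, ← Finset.mul_sum,
        stationaryMean, div_mul_cancel₀ _ hD.ne', sub_self, mul_zero])
  refine ⟨h, fun v hv => ?_⟩
  have hp' : (0 : ℝ) < pubDeg G S v := by exact_mod_cast pubDeg_pos hC2 hv
  have hN : H.neighborFinset v = S.filter fun w => G.Adj v w := by
    ext w
    rw [SimpleGraph.mem_neighborFinset, Finset.mem_filter]
    exact ⟨fun h => ⟨h.1.2, h.2⟩, fun h => ⟨⟨hv, h.1⟩, h.2⟩⟩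
  have hdeg : (H.degree v : ℝ) = pubDeg G S v := by
    rw [← SimpleGraph.card_neighborFinset_eq_degree, hN]
    simp only [pubDeg]
  have hv' := congrFun hh v
  rw [SimpleGraph.lapMatrix_mulVec_apply, hN, hdeg, if_pos hv] at hv'
  have hsum : ∑ w, moveProb G pub v w * h w =
      (∑ w ∈ S.filter fun w => G.Adj v w, h w) / pubDeg G S v := by
    simp only [moveProb_eq hC2 hv, ite_mul, zero_mul]
    rw [← Finset.sum_filter, Finset.sum_div]
    refine Finset.sum_congr ?_ fun w _ => by rw [one_div, inv_mul_eq_div]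
    ext w; simp [hS]
  rw [hsum]
  field_simp
  linarith

end Cluster

/-! ### The ergodic theorem for the designed walk -/

lemma integral_comp_of_finite {Ω A : Type*} [MeasurableSpace Ω] [Fintype A] (μ : Measure Ω)
    [IsProbabilityMeasure μ] {Z : Ω → A} (hZ : ∀ a, MeasurableSet (Z ⁻¹' {a})) (g : A → ℝ) :
    ∫ ω, g (Z ω) ∂μ = ∑ a, μ.real (Z ⁻¹' {a}) * g a := by
  let _ : MeasurableSpace A := ⊤
  have hm : Measurable Z := measurable_to_countable' hZ
  have : IsProbabilityMeasure (μ.map Z) := Measure.isProbabilityMeasure_map hm.aemeasurable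
  rw [← integral_map (f := g) hm.aemeasurable (measurable_from_top).aestronglyMeasurable,
    integral_fintype Integrable.of_finite]
  refine Finset.sum_congr rfl fun a _ => ?_
  rw [map_measureReal_apply hm (measurableSet_singleton a), smul_eq_mul]

section Walk

variable {V : Type*} [Fintype V] {G : SimpleGraph V} {pub : Set V} {S : Finset V}
  {Ω : Type*} [MeasurableSpace Ω] {μ : Measure Ω} {x : ℕ → Ω → V}

/-- The first `s + 1` samples `x 1, …, x (s + 1)` of a process indexed from `1`. -/
def samplePath (x : ℕ → Ω → V) (s : ℕ) (ω : Ω) : Fin (s + 1) → V := fun k => x (k + 1) ω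

lemma IsDesignedWalk.measurable_comp (hx : IsDesignedWalk G pub S μ x) {k : ℕ} (hk : 1 ≤ k)
    (g : V → ℝ) : Measurable fun ω => g (x k ω) := by
  let _ : MeasurableSpace V := ⊤
  exact measurable_from_top.comp (measurable_to_countable' (hx.measurable k hk))

lemma IsDesignedWalk.measurableSet_samplePath (hx : IsDesignedWalk G pub S μ x) (s : ℕ)
    (i : Fin (s + 1) → V) : MeasurableSet (samplePath x s ⁻¹' {i}) := by
  have : samplePath x s ⁻¹' {i} = ⋂ k : Fin (s + 1), x (k + 1) ⁻¹' {i k} := by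
    ext ω
    simp [samplePath, funext_iff]
  rw [this]
  exact MeasurableSet.iInter fun k => hx.measurable _ (by omega) _

lemma IsDesignedWalk.measureReal_samplePath_inter (hx : IsDesignedWalk G pub S μ x) (s : ℕ)
    (i : Fin (s + 1) → V) (w : V) :
    μ.real (samplePath x s ⁻¹' {i} ∩ x (s + 2) ⁻¹' {w}) =
      μ.real (samplePath x s ⁻¹' {i}) * moveProb G pub (i (Fin.last s)) w := by
  -- the trajectory `i` followed by `w`, reindexed from `1`
  set i' : ℕ → V := fun k => if h : k - 1 < s + 1 then i ⟨k - 1, h⟩ else w with hi'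
  have hlast : i' (s + 1) = i (Fin.last s) := by simp [hi', Fin.last]
  have hnew : i' (s + 1 + 1) = w := by simp [hi']
  have hpast : ∀ ω, (∀ k ∈ Finset.Icc 1 (s + 1), x k ω = i' k) ↔ samplePath x s ω = i := by
    intro ω
    rw [funext_iff]
    constructor
    · intro h k
      have := h (k + 1) (Finset.mem_Icc.2 ⟨by omega, by omega⟩)
      simpa [hi', samplePath, Nat.lt_succ_iff.1 k.isLt] using this
    · intro h k hk
      obtain ⟨h1, h2⟩ := Finset.mem_Icc.1 hk
      have hlt : k - 1 < s + 1 := by omega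
      have := h ⟨k - 1, hlt⟩
      simp only [samplePath, Nat.sub_add_cancel h1] at this
      rw [this]
      simp only [hi', dif_pos hlt]
  have h := hx.step (s + 1) (by omega) i'
  rw [hlast, hnew] at h
  have e1 : {ω | ∀ k ∈ Finset.Icc 1 (s + 1), x k ω = i' k} = samplePath x s ⁻¹' {i} := by
    ext ω
    exact hpast ω
  have e2 : {ω | ∀ k ∈ Finset.Icc 1 (s + 1 + 1), x k ω = i' k} =
      samplePath x s ⁻¹' {i} ∩ x (s + 2) ⁻¹' {w} := by
    ext ω
    rw [Set.mem_ofPred_eq, ← Finset.insert_Icc_right_eq_Icc_add_one (by omega),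
      Finset.forall_mem_insert, hpast, hnew, and_comm]
    rfl
  rwa [e1, e2] at h

/-- The Markov property in integrated form: against any function of the past, the next value of `h`
may be replaced by its one-step expectation. -/
lemma IsDesignedWalk.integral_mul_next [IsProbabilityMeasure μ] (hx : IsDesignedWalk G pub S μ x)
    (s : ℕ) (φ : (Fin (s + 1) → V) → ℝ) (h : V → ℝ) :
    ∫ ω, φ (samplePath x s ω) * h (x (s + 2) ω) ∂μ =
      ∫ ω, φ (samplePath x s ω) * ∑ w, moveProb G pub (x (s + 1) ω) w * h w ∂μ := by
  classical
  have hpre : ∀ a : (Fin (s + 1) → V) × V,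
      (fun ω => (samplePath x s ω, x (s + 2) ω)) ⁻¹' {a} =
        samplePath x s ⁻¹' {a.1} ∩ x (s + 2) ⁻¹' {a.2} := fun a => by
    ext ω
    simp [Prod.ext_iff]
  have h1 := integral_comp_of_finite μ (Z := fun ω => (samplePath x s ω, x (s + 2) ω))
    (fun a => by
      rw [hpre]
      exact (hx.measurableSet_samplePath s a.1).inter (hx.measurable _ (by omega) _))
    (fun a => φ a.1 * h a.2)
  have h2 := integral_comp_of_finite μ (hx.measurableSet_samplePath s)
    (fun i => φ i * ∑ w, moveProb G pub (i (Fin.last s)) w * h w)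
  have hcur : ∀ ω, samplePath x s ω (Fin.last s) = x (s + 1) ω := fun ω => by simp [samplePath]
  simp only [hcur] at h2
  rw [h1, h2, Fintype.sum_prod_type]
  refine Finset.sum_congr rfl fun i _ => ?_
  rw [Finset.mul_sum, Finset.mul_sum]
  refine Finset.sum_congr rfl fun w _ => ?_
  rw [hpre, hx.measureReal_samplePath_inter]
  ring

/-- The prediction errors of `h` along the walk have vanishing Cesàro means: they are bounded
martingale differences. -/
lemma IsDesignedWalk.ae_tendsto_prediction_error [IsProbabilityMeasure μ]
    (hx : IsDesignedWalk G pub S μ x) (h : V → ℝ) :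
    ∀ᵐ ω ∂μ, Tendsto (fun r : ℕ => (∑ k ∈ Finset.range r,
      (h (x (k + 2) ω) - ∑ w, moveProb G pub (x (k + 1) ω) w * h w)) / (r : ℝ)) atTop (𝓝 0) := by
  set P : V → ℝ := fun v => ∑ w, moveProb G pub v w * h w with hP
  set K : ℝ := ∑ v, |h v| + ∑ v, |P v| with hK
  have hbound : ∀ (u : V → ℝ) v, |u v| ≤ ∑ v, |u v| := fun u v =>
    Finset.single_le_sum (f := fun v => |u v|) (fun _ _ => abs_nonneg _) (Finset.mem_univ v)
  have hXm : ∀ k, Measurable fun ω => h (x (k + 2) ω) - P (x (k + 1) ω) := fun k =>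
    (hx.measurable_comp (by omega) h).sub (hx.measurable_comp (by omega) P)
  have hXK : ∀ k ω, |h (x (k + 2) ω) - P (x (k + 1) ω)| ≤ K := fun k ω =>
    (abs_sub _ _).trans (add_le_add (hbound h _) (hbound P _))
  refine ae_tendsto_cesaro_of_orthogonal μ hXm hXK fun j k hjk => ?_
  have hint : ∀ (u : V → ℝ) l, 1 ≤ l →
      Integrable (fun ω => (h (x (j + 2) ω) - P (x (j + 1) ω)) * u (x l ω)) μ := fun u l hl =>
    Integrable.of_bound ((hXm j).mul (hx.measurable_comp hl u)).aestronglyMeasurable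
      (K * ∑ v, |u v|) (ae_of_all _ fun ω => by
        rw [Real.norm_eq_abs, abs_mul]
        exact mul_le_mul (hXK j ω) (hbound u _) (abs_nonneg _)
          ((abs_nonneg _).trans (hXK j ω)))
  have hmark := hx.integral_mul_next k
    (fun i => h (i ⟨j + 1, by omega⟩) - P (i ⟨j, by omega⟩)) h
  simp only [mul_sub]
  rw [integral_sub (hint h _ (by omega)) (hint P _ (by omega)), sub_eq_zero]
  exact hmark

end Walk

section Limit

variable {V : Type*} [Fintype V] {G : SimpleGraph V} {pub : Set V}
  {C : (G.induce pub).ConnectedComponent}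
  {Ω : Type*} [MeasurableSpace Ω] {μ : Measure Ω} [IsProbabilityMeasure μ] {x : ℕ → Ω → V}

lemma IsDesignedWalk.ae_mem_clusterNodes (hC2 : 2 ≤ (clusterNodes G pub C).card)
    (hx : IsDesignedWalk G pub (clusterNodes G pub C) μ x) :
    ∀ᵐ ω ∂μ, ∀ k, x (k + 1) ω ∈ clusterNodes G pub C := by
  classical
  rw [ae_all_iff]
  intro k
  induction k with
  | zero => exact hx.seed
  | succ s ih =>
    -- `a (x (s + 1)) * b (x (s + 2))` indicates that the walk leaves the cluster at this step
    set a : V → ℝ := fun v => if v ∈ clusterNodes G pub C then 1 else 0 with ha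
    set b : V → ℝ := fun v => if v ∈ clusterNodes G pub C then 0 else 1 with hb
    have hzero : ∀ v, a v * ∑ w, moveProb G pub v w * b w = 0 := by
      intro v
      by_cases hv : v ∈ clusterNodes G pub C
      · refine mul_eq_zero_of_right _ (Finset.sum_eq_zero fun w _ => ?_)
        rw [moveProb_eq hC2 hv]
        by_cases hw : w ∈ clusterNodes G pub C <;> simp [hb, hw]
      · simp [ha, hv]
    have h1 := hx.integral_mul_next s (fun i => a (i (Fin.last s))) b
    have hcur : ∀ ω, samplePath x s ω (Fin.last s) = x (s + 1) ω := fun ω => by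
      simp [samplePath]
    simp only [hcur, hzero, integral_zero] at h1
    have hnn : ∀ ω, 0 ≤ a (x (s + 1) ω) * b (x (s + 2) ω) := fun ω => by
      simp only [ha, hb]
      positivity
    have hle : ∀ ω, a (x (s + 1) ω) * b (x (s + 2) ω) ≤ 1 := fun ω => by
      simp only [ha, hb]
      split_ifs <;> norm_num
    have hint : Integrable (fun ω => a (x (s + 1) ω) * b (x (s + 2) ω)) μ :=
      Integrable.of_bound ((hx.measurable_comp (by omega) a).mul
        (hx.measurable_comp (by omega) b)).aestronglyMeasurable 1
        (ae_of_all _ fun ω => by rw [Real.norm_of_nonneg (hnn ω)]; exact hle ω)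
    have h2 := (integral_eq_zero_iff_of_nonneg hnn hint).1 h1
    filter_upwards [ih, h2] with ω hω h2ω
    by_contra hne
    have hne' : x (s + 2) ω ∉ clusterNodes G pub C := hne
    simp [ha, hb, hω, hne'] at h2ω

/-- Ergodic theorem for the walk on the cluster. By the Poisson equation, `F` minus its stationary
mean is a prediction error plus a telescoping term. -/
lemma IsDesignedWalk.ae_tendsto_stationaryMean (hC2 : 2 ≤ (clusterNodes G pub C).card)
    (hx : IsDesignedWalk G pub (clusterNodes G pub C) μ x) (F : V → ℝ) :
    ∀ᵐ ω ∂μ, Tendsto (fun r : ℕ => (∑ k ∈ Finset.range r, F (x (k + 1) ω)) / (r : ℝ)) atTop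
      (𝓝 (stationaryMean G (clusterNodes G pub C) F)) := by
  obtain ⟨h, hh⟩ := exists_poisson_solution hC2 F
  filter_upwards [hx.ae_mem_clusterNodes hC2, hx.ae_tendsto_prediction_error h] with ω hS hlim
  set t := stationaryMean G (clusterNodes G pub C) F
  have hend : Tendsto (fun r : ℕ => (h (x 1 ω) - h (x (r + 1) ω)) / (r : ℝ)) atTop (𝓝 0) := by
    refine squeeze_zero_norm (a := fun r : ℕ => (2 * ∑ v, |h v|) / (r : ℝ)) (fun r => ?_)
      (tendsto_const_div_atTop_nhds_zero_nat _)
    have hb : ∀ v, |h v| ≤ ∑ v, |h v| := fun v =>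
      Finset.single_le_sum (f := fun v => |h v|) (fun _ _ => abs_nonneg _) (Finset.mem_univ v)
    rw [Real.norm_eq_abs, abs_div, Nat.abs_cast]
    gcongr
    refine (abs_sub _ _).trans ?_
    linarith [hb (x 1 ω), hb (x (r + 1) ω)]
  have hall := (hlim.add hend).add_const t
  rw [add_zero, zero_add] at hall
  refine hall.congr' ?_
  filter_upwards [eventually_gt_atTop 0] with r hr
  have hr' : (r : ℝ) ≠ 0 := by positivity
  have hF : ∀ k, F (x (k + 1) ω) =
      (h (x (k + 2) ω) - ∑ w, moveProb G pub (x (k + 1) ω) w * h w) +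
        (h (x (k + 1) ω) - h (x (k + 1 + 1) ω)) + t := fun k => by
    have := hh _ (hS k)
    linarith
  rw [Finset.sum_congr rfl fun k _ => hF k, Finset.sum_add_distrib, Finset.sum_add_distrib,
    Finset.sum_range_sub' (fun k => h (x (k + 1) ω)), Finset.sum_const, Finset.card_range,
    nsmul_eq_mul, zero_add]
  field_simp

end Limit

end PrivateWalk

/-! ### Convergence of the size estimate -/

open PrivateWalk in
theorem mainTheorem7 {V : Type*} [Fintype V] (G : SimpleGraph V) (hG : G.Connected)
    (pub : Set V) (C : (G.induce pub).ConnectedComponent)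
    (hC : PrivateWalk.IsLargestCluster G pub C)
    (hC2 : 2 ≤ (PrivateWalk.clusterNodes G pub C).card)
    {Ω : Type*} [MeasurableSpace Ω] (μ : Measure Ω) [IsProbabilityMeasure μ]
    (x : ℕ → Ω → V)
    (hx : PrivateWalk.IsDesignedWalk G pub (PrivateWalk.clusterNodes G pub C) μ x)
    (m : ℕ → ℕ) (c : ℝ) (hc : c < 1) (hm : ∀ᶠ r : ℕ in atTop, (m r : ℝ) ≤ c * (r : ℝ)) :
    ∀ᵐ ω ∂μ, Tendsto
      (fun r : ℕ => PrivateWalk.sizeEstimate G (PrivateWalk.clusterNodes G pub C) (m r) r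
        (fun k => x k ω))
      atTop (𝓝 (PrivateWalk.limitSize G (PrivateWalk.clusterNodes G pub C))) := by
  classical
  set S := clusterNodes G pub C with hS
  have hbound : ∀ (u : V → ℝ) v, |u v| ≤ ∑ v, |u v| := fun u v =>
    Finset.single_le_sum (f := fun v => |u v|) (fun _ _ => abs_nonneg _) (Finset.mem_univ v)
  have hind := ae_all_iff.2 fun v : V =>
    hx.ae_tendsto_stationaryMean hC2 (fun u => if u = v then (1 : ℝ) else 0)
  filter_upwards [hind, hx.ae_tendsto_stationaryMean hC2 (fun v => (deg G v : ℝ)),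
    hx.ae_tendsto_stationaryMean hC2 (fun v => 1 / (pubDeg G S v : ℝ))] with ω hω hdeg hinv
  rw [← hS] at hω hdeg hinv
  have hD : (0 : ℝ) < ∑ v ∈ S, (pubDeg G S v : ℝ) := sum_pubDeg_pos hC2
  have hp : ∀ v ∈ S, (0 : ℝ) < pubDeg G S v := fun v hv => by exact_mod_cast pubDeg_pos hC2 hv
  have hQ : (0 : ℝ) < ∑ v ∈ S, (pubDeg G S v : ℝ) ^ 2 :=
    Finset.sum_pos (fun v hv => pow_pos (hp v hv) 2) (Finset.card_pos.1 (by omega))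
  have hweight := tendsto_pairs_average (f := fun k => (deg G (x k ω) : ℝ))
    (g := fun k => 1 / (pubDeg G S (x k ω) : ℝ))
    (fun k => hbound (fun v => 1 / (pubDeg G S v : ℝ)) (x k ω)) hdeg hinv hc hm
  have hcoll := tendsto_finsetSum (Finset.univ : Finset V) fun v _ =>
    tendsto_pairs_average (f := fun k => if x k ω = v then (1 : ℝ) else 0)
      (g := fun k => if x k ω = v then (1 : ℝ) else 0)
      (fun k => hbound (fun u => if u = v then (1 : ℝ) else 0) (x k ω)) (hω v) (hω v) hc hm
  have hmeanInd : ∀ v, stationaryMean G S (fun u => if u = v then (1 : ℝ) else 0) =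
      if v ∈ S then (pubDeg G S v : ℝ) / ∑ v ∈ S, (pubDeg G S v : ℝ) else 0 := by
    intro v
    simp only [stationaryMean, mul_ite, mul_one, mul_zero, Finset.sum_ite_eq']
    split_ifs <;> simp
  have hmeanInv : stationaryMean G S (fun v => 1 / (pubDeg G S v : ℝ)) =
      (S.card : ℝ) / ∑ v ∈ S, (pubDeg G S v : ℝ) := by
    rw [stationaryMean, Finset.sum_congr rfl fun v hv => mul_one_div_cancel (hp v hv).ne']
    simp
  have hcollLim : ∑ v, stationaryMean G S (fun u => if u = v then (1 : ℝ) else 0) *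
      stationaryMean G S (fun u => if u = v then (1 : ℝ) else 0) =
        (∑ v ∈ S, (pubDeg G S v : ℝ) ^ 2) / (∑ v ∈ S, (pubDeg G S v : ℝ)) ^ 2 := by
    simp only [hmeanInd, ← sq, ite_pow, div_pow, zero_pow two_ne_zero]
    simp [← Finset.sum_div]
  rw [hcollLim] at hcoll
  have hdiv := hweight.div hcoll (by positivity)
  have hlim : stationaryMean G S (fun v => (deg G v : ℝ)) *
      stationaryMean G S (fun v => 1 / (pubDeg G S v : ℝ)) /
        ((∑ v ∈ S, (pubDeg G S v : ℝ) ^ 2) / (∑ v ∈ S, (pubDeg G S v : ℝ)) ^ 2) =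
      limitSize G S := by
    rw [hmeanInv, stationaryMean, limitSize]
    field_simp
  rw [hlim] at hdiv
  refine hdiv.congr fun r => ?_
  simp only [Pi.div_apply]
  rw [sizeEstimate, weightAvg, collisionAvg]
  congr 1
  · simp only [mul_one_div]
  · rw [← Finset.mul_sum, Finset.sum_comm]
    congr 1
    refine Finset.sum_congr rfl fun p _ => ?_
    simp [eq_comm]
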